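/- Let $\mu$ be a probability measure on $\mathbb Z^2$, let $S=(S_1,S_2)$ be the random walk on $\mathbb Z^2$ with transition probabilities $p(z,z')=\mu(z'-z)$, write $\mathbb N^*=\{1,2,\dots\}$, and let $Z_+$ be the walk killed on leaving $\mathbb N^*\times\mathbb N^*$, that is, the substochastic Markov chain on $\mathbb N^*\times\mathbb N^*$ with transition matrix $(\mu(z'-z))_{z,z'\in\mathbb N^*\times\mathbb N^*}$. Assume: (H1) $S$ is irreducible on $\mathbb Z^2$ and $m=\sum_{z}z\,\mu(z)\neq 0$; (H2) $Z_+$ is irreducible on $\mathbb N^*\times\mathbb N^*$; (H3) $\varphi(a)=\sum_{z\in\mathbb Z^2}\mu(z)e^{a\cdot z}$ is finite for every $a\in\mathbb R^2$; (H4) the random walks $S_1$ and $S_2$ on $\mathbb Z$ are aperiodic (have period $1$). Put $q(a)=\nabla\varphi(a)/|\nabla\varphi(a)|$ and $\Gamma_+=\{a\in\mathbb R^2:\varphi(a)=1,\ q(a)\in[0,\infty)^2\}$. Let $\mathbb P_z$, $\mathbb E_z$ refer to the walk $S$ started at $z$, and let $\tau=\inf\{n\ge 0: S(n)\notin\mathbb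 N^*\times\mathbb N^*\}$. For $a\in\Gamma_+$ and $z=(x_1,x_2)\in\mathbb N^*\times\mathbb N^*$ set $$h_a(z)=\begin{cases}x_1e^{a\cdot z}-\mathbb E_z\big(S_1(\tau)e^{a\cdot S(\tau)},\ \tau<\infty\big)&\text{if }q(a)=(0,1),\\ x_2e^{a\cdot z}-\mathbb E_z\big(S_2(\tau)e^{a\cdot S(\tau)},\ \tau<\infty\big)&\text{if }q(a)=(1,0),\\ e^{a\cdot z}-\mathbb E_z\big(e^{a\cdot S(\tau)},\ \tau<\infty\big)&\text{otherwise.}\end{cases}$$ Then, for every $a\in\Gamma_+$, the function $h_a$ is finite on $\mathbb N^*\times\mathbb N^*$ (the expectation in its definition converges absolutely for every $z\in\mathbb N^*\times\mathbb N^*$), strictly positive on $\mathbb N^*\times\mathbb N^*$, and harmonic for $Z_+$: $$\sum_{z'\in\mathbb N^*\times\mathbb N^*}\mu(z'-z)\,h_a(z')=h_a(z)\qquad\text{for all }z\in\mathbb N^*\times\mathbb N^*.$$ -/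

import Mathlib

open MeasureTheory
open scoped ENNReal

noncomputable section

namespace KilledWalk

/-! ### Countable (sub)stochastic transition matrices -/

section Chains

variable {E : Type*}

open Classical in
/-- `n`-step transition probabilities of a (sub)stochastic transition matrix `p` on `E`. -/
def nStep (p : E → E → ℝ≥0∞) : ℕ → E → E → ℝ≥0∞
  | 0, z, w => if z = w then 1 else 0
  | n + 1, z, w => ∑' u, p z u * nStep p n u w

/-- Every state can be reached from every state with positive probability. -/
def IsIrreducible (p : E → E → ℝ≥0∞) : Prop :=
  ∀ z w, ∃ n, 0 < nStep p n z w

/-- Every state `z` has period `1`: the only common divisor of the possible return times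
`{n ≥ 1 : pⁿ(z, z) > 0}` is `1`. -/
def IsAperiodic (p : E → E → ℝ≥0∞) : Prop :=
  ∀ z, ∀ d : ℕ, (∀ n, 0 < n → 0 < nStep p n z z → d ∣ n) → d = 1

/-- `f` is harmonic for the chain with transition matrix `p`: for every `z`, the series
`∑ w, p z w * f w` converges absolutely and its sum is `f z`. -/
def IsHarmonic (p : E → E → ℝ≥0∞) (f : E → ℝ) : Prop :=
  ∀ z, HasSum (fun w => (p z w).toReal * f w) (f z)

end Chains

/-- Transition probabilities `p(z, z') = μ(z' - z)` of the homogeneous random walk on `G` with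
jump law `μ`. -/
def walkTransition {G : Type*} [AddGroup G] [MeasurableSpace G] (μ : Measure G) :
    G → G → ℝ≥0∞ :=
  fun z w => μ {w - z}

/-- The open quadrant `ℕ* × ℕ*` in `ℤ²`. -/
def quadrant : Set (ℤ × ℤ) := {z | 0 < z.1 ∧ 0 < z.2}

/-- Substochastic transition matrix `p(z, z') = μ(z' - z)`, `z, z' ∈ ℕ* × ℕ*`, of the walk killed
when it leaves the quadrant. -/
def killedTransition (μ : Measure (ℤ × ℤ)) : quadrant → quadrant → ℝ≥0∞ :=
  fun z w => walkTransition μ (z : ℤ × ℤ) (w : ℤ × ℤ)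

/-- The plane `ℝ²` with its Euclidean norm. -/
abbrev Plane : Type := EuclideanSpace ℝ (Fin 2)

/-- The scalar product `a · z` of `a ∈ ℝ²` and `z ∈ ℤ²`. -/
def dot (a : Plane) (z : ℤ × ℤ) : ℝ := a 0 * z.1 + a 1 * z.2

/-! ### The jump law -/

section JumpLaw

variable (μ : Measure (ℤ × ℤ))

/-- The mean jump `m = ∑ z μ(z)`. -/
def meanJump : Plane :=
  !₂[∑' z : ℤ × ℤ, (z.1 : ℝ) * μ.real {z}, ∑' z : ℤ × ℤ, (z.2 : ℝ) * μ.real {z}]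

/-- The jump generating function is finite everywhere on `ℝ²`. -/
def FiniteGenFun : Prop :=
  ∀ a : Plane, Summable fun z : ℤ × ℤ => μ.real {z} * Real.exp (dot a z)

/-- The jump generating function `φ(a) = ∑ μ(z) exp(a · z)`. -/
def genFun (a : Plane) : ℝ := ∑' z : ℤ × ℤ, μ.real {z} * Real.exp (dot a z)

/-- The set `∂D = {a : φ(a) = 1}`, where `D = {a : φ(a) ≤ 1}`. -/
def boundaryD : Set Plane := {a | genFun μ a = 1}

/-- The direction `q(a) = ∇φ(a) / |∇φ(a)|`. -/
def direction (a : Plane) : Plane := ‖gradient (genFun μ) a‖⁻¹ • gradient (genFun μ) a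

/-- The arc `{q ∈ ℝ₊² : |q| = 1}`. -/
def posArc : Set Plane := {q | ‖q‖ = 1 ∧ 0 ≤ q 0 ∧ 0 ≤ q 1}

/-- `Γ₊ = {a ∈ ∂D : q(a) ∈ 𝓢²₊}`. -/
def gammaPlus : Set Plane := {a | a ∈ boundaryD μ ∧ direction μ a ∈ posArc}

end JumpLaw

/-! ### The random walk `S` started at `z`, its exit time from the quadrant, and `h_a` -/

/-- Law of an i.i.d. sequence of jumps with common law `μ`. -/
def pathLaw (μ : Measure (ℤ × ℤ)) [IsProbabilityMeasure μ] : Measure (ℕ → ℤ × ℤ) :=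
  Measure.infinitePi fun _ : ℕ => μ

/-- `S(n)`, the walk started at `z` whose successive jumps are `ξ 0, ξ 1, …`. -/
def walk (z : ℤ × ℤ) (n : ℕ) (ξ : ℕ → ℤ × ℤ) : ℤ × ℤ :=
  z + ∑ k ∈ Finset.range n, ξ k

/-- `τ = inf {n ≥ 0 : S(n) ∉ ℕ* × ℕ*}`, with value `⊤` if the walk never leaves the quadrant. -/
def exitTime (z : ℤ × ℤ) : (ℕ → ℤ × ℤ) → WithTop ℕ :=
  hittingAfter (walk z) quadrantᶜ 0

/-- `S(τ)`; only meaningful on the event `τ < ∞`. -/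
def exitPosition (z : ℤ × ℤ) : (ℕ → ℤ × ℤ) → ℤ × ℤ :=
  stoppedValue (walk z) (exitTime z)

open Classical in
/-- The function of `w = (w₁, w₂)` that enters the definition of `h_a`: it is
`w₁ exp(a · w)` if `q(a) = (0, 1)`, `w₂ exp(a · w)` if `q(a) = (1, 0)`, and
`exp(a · w)` otherwise. -/
def base (μ : Measure (ℤ × ℤ)) (a : Plane) (w : ℤ × ℤ) : ℝ :=
  if direction μ a = !₂[0, 1] then w.1 * Real.exp (dot a w)
  else if direction μ a = !₂[1, 0] then w.2 * Real.exp (dot a w)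
  else Real.exp (dot a w)

/-- The expectation `E_z(base(S(τ)), τ < ∞)` is finite (absolutely convergent). -/
def FiniteExitExpectation (μ : Measure (ℤ × ℤ)) [IsProbabilityMeasure μ] (a : Plane)
    (z : ℤ × ℤ) : Prop :=
  IntegrableOn (fun ξ => base μ a (exitPosition z ξ)) {ξ | exitTime z ξ < ⊤} (pathLaw μ)

/-- `h_a(z) = base(z) - E_z(base(S(τ)), τ < ∞)`. -/
def h (μ : Measure (ℤ × ℤ)) [IsProbabilityMeasure μ] (a : Plane) (z : ℤ × ℤ) : ℝ :=
  base μ a z - ∫ ξ in {ξ | exitTime z ξ < ⊤}, base μ a (exitPosition z ξ) ∂(pathLaw μ)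

end KilledWalk

end

noncomputable section

namespace KilledWalk

/-! ### The first jump of the walk -/

/-! Write b for `base μ a`. Since φ(a) = 1, the function exp(a·z) is harmonic for the free walk. If
moreover the derivative of φ at a vanishes in the direction of a coordinate vector e, then
(e·z)exp(a·z) is harmonic too; this is the situation when q(a) is a coordinate vector and e is the
other one. So h_a is always `killedPart μ b` with b harmonic for the free walk and nonnegative in
the quadrant.

Once E_z(|b(S(τ))|, τ < ∞) is finite, conditioning on the first jump makes the killed part harmonic
(`isHarmonic_killedPart`), and optional stopping makes it nonnegative (`killedPart_nonneg`).
Irreducibility of the killed walk then spreads strict positivity from one point to all.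

Finiteness and positivity at one point both come from the comparison
`exitMoment_le_of_superharmonic`: a nonnegative W, superharmonic in the quadrant, that dominates |b|
(respectively b) outside also dominates the exit expectation. What remains is to find W. In
`killedPart_exp` it is b itself for finiteness, and for positivity a sum of two exponentials with
exponents moved from a into {φ ≤ 1}. In `killedPart_dot_mul_exp`, finiteness needs a corrected
linear function built on `abs_le_add_exp`, while one exponential suffices for positivity. -/

/-- The sequence of jumps with first jump `x` and later jumps `ξ`. -/
def consJump (x : ℤ × ℤ) (ξ : ℕ → ℤ × ℤ) : ℕ → ℤ × ℤ
  | 0 => x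
  | n + 1 => ξ n

lemma measurable_consJump :
    Measurable fun p : (ℤ × ℤ) × (ℕ → ℤ × ℤ) => consJump p.1 p.2 := by
  refine measurable_pi_lambda _ fun n => ?_
  cases n with
  | zero => exact measurable_fst
  | succ n => exact (measurable_pi_apply n).comp measurable_snd

section

variable (μ : Measure (ℤ × ℤ)) [IsProbabilityMeasure μ]

instance : IsProbabilityMeasure (pathLaw μ) := by
  unfold pathLaw; infer_instance

/-- This is the Markov property at time 1: an independent first jump put before an i.i.d. path gives
an i.i.d. path. Checking cylinder sets is enough. -/
lemma map_consJump_prod :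
    (μ.prod (pathLaw μ)).map (fun p => consJump p.1 p.2) = pathLaw μ := by
  refine Measure.eq_infinitePi _ fun s t ht => ?_
  classical
  -- The constraint at time 0 falls on the first jump, and the others move one step back. `Nat.pred`
  -- is injective away from 0, so no factor is lost.
  set s' : Finset ℕ := (s.erase 0).image Nat.pred with hs'
  set A : Set (ℤ × ℤ) := if 0 ∈ s then t 0 else Set.univ with hA
  have hpre : (fun p : (ℤ × ℤ) × (ℕ → ℤ × ℤ) => consJump p.1 p.2) ⁻¹' (Set.pi s t) =
      A ×ˢ Set.pi s' (fun n => t (n + 1)) := by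
    ext ⟨x, ξ⟩
    simp only [Set.mem_preimage, Set.mem_pi, Set.mem_prod, Finset.mem_coe, hs', hA,
      Finset.mem_image, Finset.mem_erase]
    constructor
    · intro H
      refine ⟨?_, ?_⟩
      · split_ifs with h0
        · exact H 0 h0
        · trivial
      · rintro n ⟨k, ⟨hk0, hk⟩, rfl⟩
        obtain ⟨j, rfl⟩ := Nat.exists_eq_succ_of_ne_zero hk0
        exact H _ hk
    · rintro ⟨H0, H⟩ n hn
      cases n with
      | zero => rw [if_pos hn] at H0; exact H0
      | succ n => exact H n ⟨n + 1, ⟨by simp, hn⟩, rfl⟩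
  rw [Measure.map_apply measurable_consJump
    (MeasurableSet.pi s.countable_toSet fun i _ => ht i), hpre, Measure.prod_prod, pathLaw,
    Measure.infinitePi_pi _ (fun i _ => ht _), hs', Finset.prod_image]
  · have : ∏ x ∈ s.erase 0, μ (t (x.pred + 1)) = ∏ x ∈ s.erase 0, μ (t x) :=
      Finset.prod_congr rfl fun x hx => by
        rw [← Nat.succ_eq_add_one, Nat.succ_pred (Finset.ne_of_mem_erase hx)]
    rw [this, hA]
    split_ifs with h0
    · exact Finset.mul_prod_erase s (fun i => μ (t i)) h0
    · rw [measure_univ, one_mul, Finset.erase_eq_of_notMem h0]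
  · intro x hx y hy hxy
    have h1 : x ≠ 0 := Finset.ne_of_mem_erase hx
    have h2 : y ≠ 0 := Finset.ne_of_mem_erase hy
    simp only [Nat.pred_eq_sub_one] at hxy
    omega

lemma lintegral_pathLaw_eq {F : (ℕ → ℤ × ℤ) → ℝ≥0∞} (hF : Measurable F) :
    ∫⁻ ξ, F ξ ∂(pathLaw μ) = ∫⁻ x, ∫⁻ ξ, F (consJump x ξ) ∂(pathLaw μ) ∂μ := by
  conv_lhs => rw [← map_consJump_prod μ]
  rw [lintegral_map hF measurable_consJump]
  exact lintegral_prod _ (hF.comp measurable_consJump).aemeasurable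

end

/-! ### The exit time and the exit position -/

lemma measurable_walk (z : ℤ × ℤ) (n : ℕ) : Measurable (walk z n) := by
  unfold walk
  fun_prop

lemma walk_zero (z : ℤ × ℤ) (ξ : ℕ → ℤ × ℤ) : walk z 0 ξ = z := by simp [walk]

lemma walk_succ_consJump (z x : ℤ × ℤ) (n : ℕ) (ξ : ℕ → ℤ × ℤ) :
    walk z (n + 1) (consJump x ξ) = walk (z + x) n ξ := by
  simp only [walk, Finset.sum_range_succ', consJump]
  abel

/-- The event that the walk started at `z` first leaves the quadrant at time `k`. -/
def exitAt (z : ℤ × ℤ) (k : ℕ) : Set (ℕ → ℤ × ℤ) :=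
  {ξ | walk z k ξ ∉ quadrant ∧ ∀ j < k, walk z j ξ ∈ quadrant}

lemma measurableSet_exitAt (z : ℤ × ℤ) (k : ℕ) : MeasurableSet (exitAt z k) := by
  have h : ∀ j, MeasurableSet {ξ | walk z j ξ ∈ quadrant} := fun j =>
    measurable_walk z j (Set.to_countable quadrant).measurableSet
  have : exitAt z k = {ξ | walk z k ξ ∈ quadrant}ᶜ ∩
      ⋂ j, ⋂ (_ : j < k), {ξ | walk z j ξ ∈ quadrant} := by
    ext ξ; simp [exitAt]
  rw [this]
  exact (h k).compl.inter (MeasurableSet.iInter fun j => MeasurableSet.iInter fun _ => h j)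

lemma exitAt_unique {z : ℤ × ℤ} {ξ : ℕ → ℤ × ℤ} {j k : ℕ} (hj : ξ ∈ exitAt z j)
    (hk : ξ ∈ exitAt z k) : j = k := by
  rcases lt_trichotomy j k with h | h | h
  · exact absurd (hk.2 j h) hj.1
  · exact h
  · exact absurd (hj.2 k h) hk.1

lemma exitTime_eq_of_mem_exitAt {z : ℤ × ℤ} {ξ : ℕ → ℤ × ℤ} {k : ℕ} (hk : ξ ∈ exitAt z k) :
    exitTime z ξ = (k : WithTop ℕ) := by
  have hex : ∃ j, 0 ≤ j ∧ walk z j ξ ∈ quadrantᶜ := ⟨k, Nat.zero_le _, hk.1⟩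
  rw [exitTime, hittingAfter, if_pos hex]
  congr 1
  refine le_antisymm (Nat.sInf_le ⟨Nat.zero_le _, hk.1⟩) ?_
  refine le_csInf hex fun j hj => ?_
  by_contra! hlt
  exact hj.2 (hk.2 j hlt)

lemma exitPosition_eq_of_mem_exitAt {z : ℤ × ℤ} {ξ : ℕ → ℤ × ℤ} {k : ℕ}
    (hk : ξ ∈ exitAt z k) : exitPosition z ξ = walk z k ξ := by
  rw [exitPosition, stoppedValue, exitTime_eq_of_mem_exitAt hk]
  rfl

lemma setOf_exitTime_lt_top (z : ℤ × ℤ) : {ξ | exitTime z ξ < ⊤} = ⋃ k, exitAt z k := by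
  classical
  ext ξ
  simp only [Set.mem_ofPred_eq, Set.mem_iUnion]
  constructor
  · intro hlt
    have hex : ∃ j, walk z j ξ ∉ quadrant := by
      by_contra! hne
      have : exitTime z ξ = ⊤ := by
        rw [exitTime, hittingAfter, if_neg]
        rintro ⟨j, -, hj⟩
        exact hj (hne j)
      exact absurd this hlt.ne
    exact ⟨Nat.find hex, Nat.find_spec hex, fun j hj => not_not.1 (Nat.find_min hex hj)⟩
  · rintro ⟨k, hk⟩
    rw [exitTime_eq_of_mem_exitAt hk]
    exact WithTop.coe_lt_top k

lemma consJump_mem_exitAt_succ {z : ℤ × ℤ} (hz : z ∈ quadrant) (x : ℤ × ℤ)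
    (ξ : ℕ → ℤ × ℤ) (k : ℕ) : consJump x ξ ∈ exitAt z (k + 1) ↔ ξ ∈ exitAt (z + x) k := by
  simp only [exitAt, Set.mem_ofPred_eq, walk_succ_consJump]
  refine and_congr_right fun _ => ⟨fun H j hj => ?_, fun H j hj => ?_⟩
  · rw [← walk_succ_consJump]; exact H (j + 1) (by omega)
  · cases j with
    | zero => rwa [walk_zero]
    | succ j => rw [walk_succ_consJump]; exact H j (by omega)

/-! ### Expectations at the exit time of nonnegative functions -/

section

variable (μ : Measure (ℤ × ℤ)) [IsProbabilityMeasure μ] (F : ℤ × ℤ → ℝ≥0∞)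

/-- `E_z(F(S(τ)), τ = k)`. -/
def exitMomentAt (k : ℕ) (z : ℤ × ℤ) : ℝ≥0∞ :=
  ∫⁻ ξ, (exitAt z k).indicator (fun ξ => F (walk z k ξ)) ξ ∂(pathLaw μ)

/-- `E_z(F(S(τ)), τ < ∞)`. -/
def exitMoment (z : ℤ × ℤ) : ℝ≥0∞ := ∑' k, exitMomentAt μ F k z

/-- `E_z(F(S(τ)), τ < n)`. -/
def exitMomentLT (n : ℕ) (z : ℤ × ℤ) : ℝ≥0∞ := ∑ k ∈ Finset.range n, exitMomentAt μ F k z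

lemma measurable_exitAt_indicator (k : ℕ) (z : ℤ × ℤ) :
    Measurable ((exitAt z k).indicator fun ξ => F (walk z k ξ)) :=
  ((measurable_of_countable F).comp (measurable_walk z k)).indicator (measurableSet_exitAt z k)

lemma exitMoment_eq_lintegral (z : ℤ × ℤ) :
    exitMoment μ F z = ∫⁻ ξ in {ξ | exitTime z ξ < ⊤}, F (exitPosition z ξ) ∂(pathLaw μ) := by
  rw [setOf_exitTime_lt_top, lintegral_iUnion (measurableSet_exitAt z)
    (fun i j hij => Set.disjoint_left.2 fun ξ hi hj => hij (exitAt_unique hi hj))]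
  refine tsum_congr fun k => ?_
  rw [exitMomentAt, lintegral_indicator (measurableSet_exitAt z k)]
  exact setLIntegral_congr_fun (measurableSet_exitAt z k) fun ξ hξ => by
    simp only [exitPosition_eq_of_mem_exitAt hξ]

lemma exitMomentAt_zero_of_mem {z : ℤ × ℤ} (hz : z ∈ quadrant) : exitMomentAt μ F 0 z = 0 := by
  have : exitAt z 0 = ∅ := by ext ξ; simp [exitAt, walk_zero, hz]
  simp [exitMomentAt, this]

lemma exitMomentAt_zero_of_notMem {z : ℤ × ℤ} (hz : z ∉ quadrant) :
    exitMomentAt μ F 0 z = F z := by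
  have : exitAt z 0 = Set.univ := by ext ξ; simp [exitAt, walk_zero, hz]
  simp [exitMomentAt, this, walk_zero]

lemma exitMomentAt_succ_of_notMem {z : ℤ × ℤ} (hz : z ∉ quadrant) (k : ℕ) :
    exitMomentAt μ F (k + 1) z = 0 := by
  have : exitAt z (k + 1) = ∅ := by
    ext ξ
    simp only [exitAt, Set.mem_ofPred_eq, Set.mem_empty_iff_false, iff_false, not_and, not_forall]
    exact fun _ => ⟨0, by omega, by rwa [walk_zero]⟩
  simp [exitMomentAt, this]

lemma exitMomentAt_succ_of_mem {z : ℤ × ℤ} (hz : z ∈ quadrant) (k : ℕ) :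
    exitMomentAt μ F (k + 1) z = ∫⁻ x, exitMomentAt μ F k (z + x) ∂μ := by
  rw [exitMomentAt, lintegral_pathLaw_eq μ (measurable_exitAt_indicator F (k + 1) z)]
  refine lintegral_congr fun x => lintegral_congr fun ξ => ?_
  by_cases h : ξ ∈ exitAt (z + x) k
  · rw [Set.indicator_of_mem h, Set.indicator_of_mem ((consJump_mem_exitAt_succ hz x ξ k).2 h),
      walk_succ_consJump]
  · rw [Set.indicator_of_notMem h,
      Set.indicator_of_notMem (mt (consJump_mem_exitAt_succ hz x ξ k).1 h)]

/-- The horizon must be at least 1: for horizon 0 the sum is empty and misses the exit at time 0. -/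
lemma exitMomentLT_succ_of_notMem {z : ℤ × ℤ} (hz : z ∉ quadrant) (n : ℕ) :
    exitMomentLT μ F (n + 1) z = F z := by
  rw [exitMomentLT, Finset.sum_range_succ', exitMomentAt_zero_of_notMem μ F hz]
  simp [exitMomentAt_succ_of_notMem μ F hz]

lemma exitMomentLT_succ_of_mem {z : ℤ × ℤ} (hz : z ∈ quadrant) (n : ℕ) :
    exitMomentLT μ F (n + 1) z = ∫⁻ x, exitMomentLT μ F n (z + x) ∂μ := by
  simp only [exitMomentLT]
  rw [Finset.sum_range_succ', exitMomentAt_zero_of_mem μ F hz, add_zero,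
    lintegral_finsetSum _ fun _ _ => measurable_of_countable _]
  simp [exitMomentAt_succ_of_mem μ F hz]

lemma exitMoment_eq_iSup (z : ℤ × ℤ) : exitMoment μ F z = ⨆ n, exitMomentLT μ F n z :=
  ENNReal.tsum_eq_iSup_nat

lemma exitMoment_of_notMem {z : ℤ × ℤ} (hz : z ∉ quadrant) : exitMoment μ F z = F z := by
  rw [exitMoment, tsum_eq_single 0, exitMomentAt_zero_of_notMem μ F hz]
  intro k hk
  obtain ⟨j, rfl⟩ := Nat.exists_eq_succ_of_ne_zero hk
  exact exitMomentAt_succ_of_notMem μ F hz j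

lemma exitMoment_of_mem {z : ℤ × ℤ} (hz : z ∈ quadrant) :
    exitMoment μ F z = ∫⁻ x, exitMoment μ F (z + x) ∂μ := by
  simp only [exitMoment]
  rw [lintegral_tsum fun _ => (measurable_of_countable _).aemeasurable,
    tsum_eq_zero_add' ENNReal.summable, exitMomentAt_zero_of_mem μ F hz, zero_add]
  simp [exitMomentAt_succ_of_mem μ F hz]

/-- `E_z(F(S(τ)), τ < ∞) ≤ V(z)` if `V` is superharmonic in the quadrant and `F ≤ V` outside. -/
lemma exitMoment_le_of_superharmonic {V : ℤ × ℤ → ℝ≥0∞} (hFV : ∀ z ∉ quadrant, F z ≤ V z)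
    (hV : ∀ z ∈ quadrant, ∫⁻ x, V (z + x) ∂μ ≤ V z) (z : ℤ × ℤ) : exitMoment μ F z ≤ V z := by
  rw [exitMoment_eq_iSup]
  refine iSup_le fun n => ?_
  induction n generalizing z with
  | zero => simp [exitMomentLT]
  | succ n ih =>
    by_cases hz : z ∈ quadrant
    · rw [exitMomentLT_succ_of_mem μ F hz]
      exact (lintegral_mono fun x => ih (z + x)).trans (hV z hz)
    · rw [exitMomentLT_succ_of_notMem μ F hz]
      exact hFV z hz

end

/-! ### Positivity of harmonic functions -/

/-- For nonnegative f, harmonicity gives f z ≥ p z u * f u, so positivity propagates backwards along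
a path leading to z₀. -/
lemma IsHarmonic.pos_of_irreducible {E : Type*} {p : E → E → ℝ≥0∞} {f : E → ℝ}
    (hf : IsHarmonic p f) (hp : ∀ z w, p z w ≠ ⊤) (hirr : IsIrreducible p) (h0 : ∀ z, 0 ≤ f z)
    {z₀ : E} (hz₀ : 0 < f z₀) (z : E) : 0 < f z := by
  obtain ⟨n, hn⟩ := hirr z z₀
  induction n generalizing z with
  | zero =>
    by_cases h : z = z₀
    · rwa [h]
    · simp [nStep, h] at hn
  | succ n ih =>
    obtain ⟨u, hu⟩ : ∃ u, p z u * nStep p n u z₀ ≠ 0 := by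
      by_contra! hne
      simp [nStep, hne] at hn
    have h1 : 0 < (p z u).toReal := ENNReal.toReal_pos (left_ne_zero_of_mul hu) (hp z u)
    have h2 : 0 < f u := ih u (pos_iff_ne_zero.2 (right_ne_zero_of_mul hu))
    calc 0 < (p z u).toReal * f u := mul_pos h1 h2
      _ ≤ f z := le_hasSum (hf z) u fun w _ => mul_nonneg ENNReal.toReal_nonneg (h0 w)

/-! ### Sums against a measure on a countable space -/

lemma hasSum_measureReal_mul_of_integrable {X : Type*} [Countable X] [MeasurableSpace X]
    [MeasurableSingletonClass X] {ν : Measure X} {f : X → ℝ} (hf : Integrable f ν) :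
    HasSum (fun x => ν.real {x} * f x) (∫ x, f x ∂ν) := by
  have hf' := hf
  rw [← Measure.sum_smul_dirac ν] at hf'
  have := hasSum_integral_measure hf'
  rw [Measure.sum_smul_dirac] at this
  simpa [measureReal_def] using this

lemma integrable_iff_summable_measureReal {X : Type*} [Countable X] [MeasurableSpace X]
    [MeasurableSingletonClass X] {ν : Measure X} [IsFiniteMeasure ν] {f : X → ℝ} :
    Integrable f ν ↔ Summable fun x => ν.real {x} * ‖f x‖ := by
  conv_lhs => rw [← Measure.sum_smul_dirac ν]
  exact integrable_sum_dirac_iff fun x => measure_ne_top ν {x}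

/-! ### The killed walk and a harmonic function of the free walk -/

section

variable (μ : Measure (ℤ × ℤ)) [IsProbabilityMeasure μ] (b : ℤ × ℤ → ℝ)

/-- `b(z) - E_z(b(S(τ)), τ < ∞)`. -/
def killedPart (z : ℤ × ℤ) : ℝ :=
  b z - ∫ ξ in {ξ | exitTime z ξ < ⊤}, b (exitPosition z ξ) ∂(pathLaw μ)

lemma exitMoment_mono {F G : ℤ × ℤ → ℝ≥0∞} (hFG : ∀ z, F z ≤ G z) (z : ℤ × ℤ) :
    exitMoment μ F z ≤ exitMoment μ G z := by
  simp only [exitMoment_eq_lintegral]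
  exact lintegral_mono fun ξ => hFG _

lemma aestronglyMeasurable_exit (z : ℤ × ℤ) :
    AEStronglyMeasurable (fun ξ => b (exitPosition z ξ))
      ((pathLaw μ).restrict {ξ | exitTime z ξ < ⊤}) := by
  rw [setOf_exitTime_lt_top, aestronglyMeasurable_iUnion_iff]
  intro k
  have hm : Measurable fun ξ => b (walk z k ξ) :=
    (measurable_of_countable b).comp (measurable_walk z k)
  refine hm.aestronglyMeasurable.congr ?_
  filter_upwards [ae_restrict_mem (measurableSet_exitAt z k)] with ξ hξ
  rw [exitPosition_eq_of_mem_exitAt hξ]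

lemma integrableOn_exit {z : ℤ × ℤ} (hfin : exitMoment μ (fun w => ‖b w‖ₑ) z ≠ ⊤) :
    IntegrableOn (fun ξ => b (exitPosition z ξ)) {ξ | exitTime z ξ < ⊤} (pathLaw μ) := by
  refine ⟨aestronglyMeasurable_exit μ b z, ?_⟩
  rw [HasFiniteIntegral, ← exitMoment_eq_lintegral μ (fun w => ‖b w‖ₑ) z]
  exact hfin.lt_top

variable {b}

/-- Since b may change sign, splitting it brings everything back to the `ℝ≥0∞`-valued moments, for
which first-jump identities need no integrability. -/
lemma killedPart_eq {z : ℤ × ℤ} (hfin : exitMoment μ (fun w => ‖b w‖ₑ) z ≠ ⊤) :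
    killedPart μ b z = b z - ((exitMoment μ (fun w => ENNReal.ofReal (b w)) z).toReal -
      (exitMoment μ (fun w => ENNReal.ofReal (-b w)) z).toReal) := by
  rw [killedPart, integral_eq_lintegral_pos_part_sub_lintegral_neg_part
    (integrableOn_exit μ b hfin), exitMoment_eq_lintegral, exitMoment_eq_lintegral]

lemma exitMoment_ofReal_ne_top {z : ℤ × ℤ} (hfin : exitMoment μ (fun w => ‖b w‖ₑ) z ≠ ⊤) :
    exitMoment μ (fun w => ENNReal.ofReal (b w)) z ≠ ⊤ :=
  ne_top_of_le_ne_top hfin (exitMoment_mono μ (fun _ => Real.ofReal_le_enorm _) z)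

lemma exitMoment_ofReal_neg_ne_top {z : ℤ × ℤ}
    (hfin : exitMoment μ (fun w => ‖b w‖ₑ) z ≠ ⊤) :
    exitMoment μ (fun w => ENNReal.ofReal (-b w)) z ≠ ⊤ :=
  ne_top_of_le_ne_top hfin (exitMoment_mono μ
    (fun _ => (Real.ofReal_le_enorm _).trans_eq (enorm_neg _)) z)

lemma killedPart_of_notMem {z : ℤ × ℤ} (hz : z ∉ quadrant) : killedPart μ b z = 0 := by
  rw [killedPart_eq μ (by rw [exitMoment_of_notMem μ _ hz]; exact enorm_ne_top),
    exitMoment_of_notMem μ _ hz, exitMoment_of_notMem μ _ hz]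
  rcases le_total 0 (b z) with h | h
  · simp [ENNReal.toReal_ofReal, ENNReal.ofReal_of_nonpos (neg_nonpos.2 h), h]
  · simp [ENNReal.toReal_ofReal, ENNReal.ofReal_of_nonpos h, h]

variable (hfin : ∀ z, exitMoment μ (fun w => ‖b w‖ₑ) z ≠ ⊤)
  (hint : ∀ z, Integrable (fun x => b (z + x)) μ) (hharm : ∀ z, ∫ x, b (z + x) ∂μ = b z)

include hfin hint hharm in
lemma killedPart_mean {z : ℤ × ℤ} (hz : z ∈ quadrant) :
    Integrable (fun x => killedPart μ b (z + x)) μ ∧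
      ∫ x, killedPart μ b (z + x) ∂μ = killedPart μ b z := by
  have key : ∀ F : ℤ × ℤ → ℝ≥0∞, (∀ w, exitMoment μ F w ≠ ⊤) →
      Integrable (fun x => (exitMoment μ F (z + x)).toReal) μ ∧
        ∫ x, (exitMoment μ F (z + x)).toReal ∂μ = (exitMoment μ F z).toReal := by
    intro F hF
    have hm : AEMeasurable (fun x => exitMoment μ F (z + x)) μ :=
      (measurable_of_countable _).aemeasurable
    have h1 := exitMoment_of_mem μ F hz
    refine ⟨integrable_toReal_of_lintegral_ne_top hm (h1 ▸ hF z), ?_⟩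
    rw [integral_toReal hm (Filter.Eventually.of_forall fun x => (hF _).lt_top), ← h1]
  obtain ⟨i1, e1⟩ := key _ fun w => exitMoment_ofReal_ne_top μ (hfin w)
  obtain ⟨i2, e2⟩ := key _ fun w => exitMoment_ofReal_neg_ne_top μ (hfin w)
  have heq : (fun x => killedPart μ b (z + x)) = fun x => b (z + x) -
      ((exitMoment μ (fun w => ENNReal.ofReal (b w)) (z + x)).toReal -
        (exitMoment μ (fun w => ENNReal.ofReal (-b w)) (z + x)).toReal) :=
    funext fun x => killedPart_eq μ (hfin _)
  have i3 : Integrable (fun x => (exitMoment μ (fun w => ENNReal.ofReal (b w)) (z + x)).toReal -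
      (exitMoment μ (fun w => ENNReal.ofReal (-b w)) (z + x)).toReal) μ := i1.sub i2
  rw [heq, killedPart_eq μ (hfin z)]
  refine ⟨(hint z).sub i3, ?_⟩
  rw [integral_sub (hint z) i3, integral_sub i1 i2, hharm, e1, e2]

include hfin hint hharm in
lemma isHarmonic_killedPart :
    IsHarmonic (killedTransition μ) fun z => killedPart μ b (z : ℤ × ℤ) := by
  rintro ⟨z, hz⟩
  obtain ⟨hi, he⟩ := killedPart_mean μ hfin hint hharm hz
  have hs := hasSum_measureReal_mul_of_integrable hi
  rw [he] at hs
  have hs' : HasSum (fun w : ℤ × ℤ => μ.real {w - z} * killedPart μ b w) (killedPart μ b z) := by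
    rw [← (Equiv.addLeft z).hasSum_iff]
    simpa [Function.comp_def] using hs
  -- Outside the quadrant τ = 0 and the killed part vanishes, so the sum over all of ℤ² is the sum
  -- over the quadrant.
  have hsupp : Function.support (fun w : ℤ × ℤ => μ.real {w - z} * killedPart μ b w) ⊆
      quadrant := by
    intro w hw
    by_contra hwq
    exact hw (by simp [killedPart_of_notMem μ hwq])
  exact (hasSum_subtype_iff_of_support_subset hsupp).2 hs'

-- Optional stopping at τ ∧ n: since b ≥ 0 before the exit, E_z(b(S(τ)), τ ≤ n) ≤ b(z), and n tends
-- to infinity.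
include hfin hint hharm in
lemma killedPart_nonneg (hpos : ∀ z ∈ quadrant, 0 ≤ b z) {z : ℤ × ℤ} (hz : z ∈ quadrant) :
    0 ≤ killedPart μ b z := by
  set P : ℤ × ℤ → ℝ≥0∞ := fun w => ENNReal.ofReal (b w)
  set N : ℤ × ℤ → ℝ≥0∞ := fun w => ENNReal.ofReal (-b w)
  have hN : ∀ z, ∫⁻ x, N (z + x) ∂μ ≠ ⊤ := fun z => (hint z).neg.lintegral_lt_top.ne
  have hP : ∀ z, ∫⁻ x, P (z + x) ∂μ ≠ ⊤ := fun z => (hint z).lintegral_lt_top.ne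
  have hstep : ∀ z ∈ quadrant, ∫⁻ x, P (z + x) ∂μ = ∫⁻ x, N (z + x) ∂μ + P z := by
    intro z hz
    have h := integral_eq_lintegral_pos_part_sub_lintegral_neg_part (hint z)
    rw [hharm z] at h
    have hb : P z = ENNReal.ofReal ((∫⁻ x, P (z + x) ∂μ).toReal -
      (∫⁻ x, N (z + x) ∂μ).toReal) := congrArg ENNReal.ofReal h
    have h0 := hpos z hz
    rw [← ENNReal.ofReal_toReal (hP z), ← ENNReal.ofReal_toReal (hN z),
      ← ENNReal.ofReal_add ENNReal.toReal_nonneg h0]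
    congr 1
    exact (eq_add_of_sub_eq' h.symm)
  -- The stopped inequality with negative parts moved across, to avoid subtraction in `ℝ≥0∞`. In the
  -- induction step, `hstep` makes the finite term ∫ N(z + x) appear on both sides, where it
  -- cancels.
  have hbound : ∀ n z, exitMomentLT μ P (n + 1) z + N z ≤ exitMomentLT μ N (n + 1) z + P z := by
    intro n
    induction n with
    | zero =>
      intro z
      by_cases hz : z ∈ quadrant
      · have : N z = 0 := ENNReal.ofReal_eq_zero.2 (neg_nonpos.2 (hpos z hz))
        rw [this]
        simp [exitMomentLT, exitMomentAt_zero_of_mem μ _ hz]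
      · rw [exitMomentLT_succ_of_notMem μ _ hz, exitMomentLT_succ_of_notMem μ _ hz, add_comm]
    | succ n ih =>
      intro z
      by_cases hz : z ∈ quadrant
      · have hNz : N z = 0 := ENNReal.ofReal_eq_zero.2 (neg_nonpos.2 (hpos z hz))
        rw [exitMomentLT_succ_of_mem μ _ hz, exitMomentLT_succ_of_mem μ _ hz, hNz, add_zero]
        have h := lintegral_mono (μ := μ) fun x => ih (z + x)
        rw [lintegral_add_left (measurable_of_countable _),
          lintegral_add_left (measurable_of_countable _), hstep z hz, add_comm (lintegral μ _) (P z),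
          ← add_assoc] at h
        exact (ENNReal.add_le_add_iff_right (hN z)).1 h
      · rw [exitMomentLT_succ_of_notMem μ _ hz, exitMomentLT_succ_of_notMem μ _ hz, add_comm]
  have hle : exitMoment μ P z ≤ exitMoment μ N z + P z := by
    rw [exitMoment_eq_iSup μ P]
    refine iSup_le fun n => ?_
    calc exitMomentLT μ P n z ≤ exitMomentLT μ P (n + 1) z :=
          Finset.sum_le_sum_of_subset (Finset.range_mono n.le_succ)
      _ ≤ exitMomentLT μ P (n + 1) z + N z := le_self_add
      _ ≤ exitMomentLT μ N (n + 1) z + P z := hbound n z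
      _ ≤ exitMoment μ N z + P z := by
        rw [exitMoment_eq_iSup μ N]
        gcongr
        exact le_iSup (fun n => exitMomentLT μ N n z) (n + 1)
  have hNt : exitMoment μ N z ≠ ⊤ := exitMoment_ofReal_neg_ne_top μ (hfin z)
  have h := ENNReal.toReal_mono (ENNReal.add_ne_top.2 ⟨hNt, ENNReal.ofReal_ne_top⟩) hle
  rw [ENNReal.toReal_add hNt ENNReal.ofReal_ne_top, ENNReal.toReal_ofReal (hpos z hz)] at h
  rw [killedPart_eq μ (hfin z)]
  linarith

/-- Negative values of b at the exit only increase the killed part, so W need dominate b and not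
|b|. -/
lemma killedPart_pos_of_superharmonic {z : ℤ × ℤ}
    (hfin : exitMoment μ (fun w => ‖b w‖ₑ) z ≠ ⊤) {W : ℤ × ℤ → ℝ}
    (hW0 : ∀ w, 0 ≤ W w) (hbW : ∀ w ∉ quadrant, b w ≤ W w)
    (hWint : ∀ w, Integrable (fun x => W (w + x)) μ)
    (hW : ∀ w ∈ quadrant, ∫ x, W (w + x) ∂μ ≤ W w) (hz : W z < b z) :
    0 < killedPart μ b z := by
  have h : exitMoment μ (fun w => ENNReal.ofReal (b w)) z ≤ ENNReal.ofReal (W z) := by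
    refine exitMoment_le_of_superharmonic μ _ (V := fun w => ENNReal.ofReal (W w))
      (fun w hw => ENNReal.ofReal_le_ofReal (hbW w hw)) (fun w hw => ?_) z
    rw [← ofReal_integral_eq_lintegral_ofReal (hWint w) (Filter.Eventually.of_forall fun x => hW0 _)]
    exact ENNReal.ofReal_le_ofReal (hW w hw)
  have h' := ENNReal.toReal_mono ENNReal.ofReal_ne_top h
  rw [ENNReal.toReal_ofReal (hW0 z)] at h'
  rw [killedPart_eq μ hfin]
  have := ENNReal.toReal_nonneg (a := exitMoment μ (fun w => ENNReal.ofReal (-b w)) z)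
  linarith

lemma exitMoment_enorm_ne_top_of_superharmonic {W : ℤ × ℤ → ℝ}
    (hW0 : ∀ w, 0 ≤ W w) (hbW : ∀ w ∉ quadrant, |b w| ≤ W w)
    (hWint : ∀ w, Integrable (fun x => W (w + x)) μ)
    (hW : ∀ w ∈ quadrant, ∫ x, W (w + x) ∂μ ≤ W w) (z : ℤ × ℤ) :
    exitMoment μ (fun w => ‖b w‖ₑ) z ≠ ⊤ := by
  refine ne_top_of_le_ne_top ENNReal.ofReal_ne_top
    (exitMoment_le_of_superharmonic μ _ (V := fun w => ENNReal.ofReal (W w))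
      (fun w hw => ?_) (fun w hw => ?_) z)
  · rw [Real.enorm_eq_ofReal_abs]
    exact ENNReal.ofReal_le_ofReal (hbW w hw)
  · rw [← ofReal_integral_eq_lintegral_ofReal (hWint w) (Filter.Eventually.of_forall fun x => hW0 _)]
    exact ENNReal.ofReal_le_ofReal (hW w hw)

include hfin hint hharm in
/-- If `b` is harmonic for the free walk, nonnegative in the quadrant, has finite exit
expectations, and its killed part is positive somewhere, then the killed part of `b` is a positive
harmonic function of the killed walk. -/
lemma killedPart_pos_and_isHarmonic (hirr : IsIrreducible (killedTransition μ))
    (hpos : ∀ z ∈ quadrant, 0 ≤ b z) (hex : ∃ z ∈ quadrant, 0 < killedPart μ b z) :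
    (∀ z ∈ quadrant, IntegrableOn (fun ξ => b (exitPosition z ξ)) {ξ | exitTime z ξ < ⊤}
      (pathLaw μ)) ∧
    (∀ z ∈ quadrant, 0 < killedPart μ b z) ∧
    IsHarmonic (killedTransition μ) fun z => killedPart μ b (z : ℤ × ℤ) := by
  have hH := isHarmonic_killedPart μ hfin hint hharm
  obtain ⟨z₀, hz₀, h₀⟩ := hex
  refine ⟨fun z _ => integrableOn_exit μ b (hfin z), fun z hz => ?_, hH⟩
  exact hH.pos_of_irreducible (fun z w => measure_ne_top μ _) hirr
    (fun z => killedPart_nonneg μ hfin hint hharm hpos z.2) (z₀ := ⟨z₀, hz₀⟩) h₀ ⟨z, hz⟩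

end

/-! ### The scalar product -/

lemma dot_add_right (c : Plane) (z w : ℤ × ℤ) : dot c (z + w) = dot c z + dot c w := by
  simp only [dot, Prod.fst_add, Prod.snd_add]; push_cast; ring

lemma dot_add_left (c d : Plane) (z : ℤ × ℤ) : dot (c + d) z = dot c z + dot d z := by
  simp only [dot, PiLp.add_apply]; ring

lemma dot_sub_left (c d : Plane) (z : ℤ × ℤ) : dot (c - d) z = dot c z - dot d z := by
  simp only [dot, PiLp.sub_apply]; ring

lemma dot_smul_left (t : ℝ) (c : Plane) (z : ℤ × ℤ) : dot (t • c) z = t * dot c z := by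
  simp only [dot, PiLp.smul_apply, smul_eq_mul]; ring

lemma dot_fst (z : ℤ × ℤ) : dot !₂[1, 0] z = z.1 := by simp [dot]

lemma dot_snd (z : ℤ × ℤ) : dot !₂[0, 1] z = z.2 := by simp [dot]

/-! ### The jump generating function -/

section

variable {μ : Measure (ℤ × ℤ)}

lemma hasDerivAt_genFun_line {a : Plane} (ha : DifferentiableAt ℝ (genFun μ) a) (d : Plane) :
    HasDerivAt (fun t : ℝ => genFun μ (a + t • d)) (inner ℝ (gradient (genFun μ) a) d) 0 := by
  have h1 : HasDerivAt (fun t : ℝ => a + t • d) d 0 := by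
    simpa using ((hasDerivAt_id (0 : ℝ)).smul_const d).const_add a
  have h2 := ha.hasGradientAt.hasFDerivAt
  have h3 : a = a + (0 : ℝ) • d := by simp
  rw [h3] at h2
  simpa [Function.comp_def] using h2.comp_hasDerivAt (0 : ℝ) h1

lemma exists_genFun_lt {a : Plane} (ha : DifferentiableAt ℝ (genFun μ) a) {d : Plane}
    (hd : inner ℝ (gradient (genFun μ) a) d < 0) :
    ∃ t : ℝ, 0 < t ∧ genFun μ (a + t • d) < genFun μ a := by
  have h := (hasDerivAt_genFun_line ha d).tendsto_slope_zero_right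
  have h1 := h.eventually (gt_mem_nhds hd)
  obtain ⟨t, ht, ht0⟩ := (h1.and self_mem_nhdsWithin).exists
  have ht0 : 0 < t := ht0
  refine ⟨t, ht0, ?_⟩
  simp only [zero_add, zero_smul, add_zero, smul_eq_mul] at ht
  have h2 : genFun μ (a + t • d) - genFun μ a < 0 := by
    by_contra! hge
    exact absurd ht (not_lt.2 (mul_nonneg (inv_nonneg.2 ht0.le) hge))
  linarith

/-- Otherwise d · S(n) would be constant in n, and the walk from 0 could not reach w. -/
lemma exists_dot_ne_zero_of_irreducible (hirr : IsIrreducible (walkTransition μ)) {d : Plane}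
    (hd : ∃ w, dot d w ≠ 0) : ∃ x, μ {x} ≠ 0 ∧ dot d x ≠ 0 := by
  by_contra! hne
  obtain ⟨w, hw⟩ := hd
  obtain ⟨n, hn⟩ := hirr 0 w
  have key : ∀ n z, 0 < nStep (walkTransition μ) n z w → dot d z = dot d w := by
    intro n
    induction n with
    | zero =>
      intro z hz
      by_cases h : z = w
      · rw [h]
      · simp [nStep, h] at hz
    | succ n ih =>
      intro z hz
      obtain ⟨u, hu⟩ : ∃ u, walkTransition μ z u * nStep (walkTransition μ) n u w ≠ 0 := by
        by_contra! hne
        simp [nStep, hne] at hz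
      have h1 := hne _ (left_ne_zero_of_mul hu)
      have h2 := ih u (pos_iff_ne_zero.2 (right_ne_zero_of_mul hu))
      have h3 := dot_add_right d (u - z) z
      rw [sub_add_cancel, h1, zero_add] at h3
      rw [← h3, h2]
  have := key n 0 hn
  rw [← this] at hw
  simp [dot] at hw

variable [IsProbabilityMeasure μ]

lemma FiniteGenFun.integrable_exp (hμ : FiniteGenFun μ) (c : Plane) :
    Integrable (fun x => Real.exp (dot c x)) μ := by
  rw [integrable_iff_summable_measureReal]
  simpa using hμ c

lemma FiniteGenFun.genFun_eq_integral (hμ : FiniteGenFun μ) (c : Plane) :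
    genFun μ c = ∫ x, Real.exp (dot c x) ∂μ :=
  (hasSum_measureReal_mul_of_integrable (hμ.integrable_exp c)).tsum_eq

lemma FiniteGenFun.integrable_dot_mul_exp (hμ : FiniteGenFun μ) (d c : Plane) :
    Integrable (fun x => dot d x * Real.exp (dot c x)) μ := by
  refine ((hμ.integrable_exp (c + d)).add (hμ.integrable_exp (c - d))).mono'
    (measurable_of_countable _).aestronglyMeasurable (Filter.Eventually.of_forall fun x => ?_)
  simp only [Pi.add_apply, dot_add_left, dot_sub_left, sub_eq_add_neg (dot c x), Real.exp_add]
  rw [norm_mul, Real.norm_eq_abs, Real.norm_eq_abs, Real.abs_exp, ← mul_add, mul_comm]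
  gcongr
  have h1 := Real.add_one_le_exp (dot d x)
  have h2 := Real.add_one_le_exp (-dot d x)
  have h3 := Real.exp_pos (dot d x)
  have h4 := Real.exp_pos (-dot d x)
  exact abs_le'.2 ⟨by linarith, by linarith⟩

lemma FiniteGenFun.integrable_exp_shift (hμ : FiniteGenFun μ) (c : Plane) (z : ℤ × ℤ) :
    Integrable (fun x => Real.exp (dot c (z + x))) μ := by
  simpa only [dot_add_right, Real.exp_add] using (hμ.integrable_exp c).const_mul _

lemma FiniteGenFun.integral_exp_shift (hμ : FiniteGenFun μ) (c : Plane) (z : ℤ × ℤ) :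
    ∫ x, Real.exp (dot c (z + x)) ∂μ = Real.exp (dot c z) * genFun μ c := by
  simp only [dot_add_right, Real.exp_add]
  rw [integral_const_mul, hμ.genFun_eq_integral]

lemma FiniteGenFun.integrable_dot_mul_exp_shift (hμ : FiniteGenFun μ) (d c : Plane)
    (z : ℤ × ℤ) : Integrable (fun x => dot d (z + x) * Real.exp (dot c (z + x))) μ := by
  have : (fun x => dot d (z + x) * Real.exp (dot c (z + x))) = fun x =>
      dot d z * Real.exp (dot c z) * Real.exp (dot c x) +
        Real.exp (dot c z) * (dot d x * Real.exp (dot c x)) := by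
    funext x
    rw [dot_add_right, dot_add_right, Real.exp_add]
    ring
  rw [this]
  exact ((hμ.integrable_exp c).const_mul _).add ((hμ.integrable_dot_mul_exp d c).const_mul _)

lemma FiniteGenFun.integral_dot_mul_exp_shift (hμ : FiniteGenFun μ) (d c : Plane) (z : ℤ × ℤ) :
    ∫ x, dot d (z + x) * Real.exp (dot c (z + x)) ∂μ =
      dot d z * Real.exp (dot c z) * genFun μ c +
        Real.exp (dot c z) * ∫ x, dot d x * Real.exp (dot c x) ∂μ := by
  have : (fun x => dot d (z + x) * Real.exp (dot c (z + x))) = fun x =>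
      dot d z * Real.exp (dot c z) * Real.exp (dot c x) +
        Real.exp (dot c z) * (dot d x * Real.exp (dot c x)) := by
    funext x
    rw [dot_add_right, dot_add_right, Real.exp_add]
    ring
  rw [this, integral_add ((hμ.integrable_exp c).const_mul _)
    ((hμ.integrable_dot_mul_exp d c).const_mul _), integral_const_mul, integral_const_mul,
    hμ.genFun_eq_integral]

/-- Convexity replaces differentiation under the sum: by e^s ≥ 1 + s, the function t ↦ φ(a + td) -
tM is minimal at 0, so its derivative there is zero. -/
lemma FiniteGenFun.inner_gradient (hμ : FiniteGenFun μ) {a : Plane}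
    (ha : DifferentiableAt ℝ (genFun μ) a) (d : Plane) :
    inner ℝ (gradient (genFun μ) a) d = ∫ x, dot d x * Real.exp (dot a x) ∂μ := by
  set M := ∫ x, dot d x * Real.exp (dot a x) ∂μ with hM
  have hd : HasDerivAt (fun t : ℝ => genFun μ (a + t • d) - t * M)
      (inner ℝ (gradient (genFun μ) a) d - 1 * M) 0 :=
    (hasDerivAt_genFun_line ha d).sub ((hasDerivAt_id (0 : ℝ)).mul_const M)
  have hmin : IsLocalMin (fun t : ℝ => genFun μ (a + t • d) - t * M) 0 := by
    refine Filter.Eventually.of_forall fun t => ?_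
    have hle : ∫ x, (Real.exp (dot a x) + t * (dot d x * Real.exp (dot a x))) ∂μ ≤
        ∫ x, Real.exp (dot (a + t • d) x) ∂μ := by
      refine integral_mono ((hμ.integrable_exp a).add ((hμ.integrable_dot_mul_exp d a).const_mul t))
        (hμ.integrable_exp _) fun x => ?_
      simp only [dot_add_left, dot_smul_left, Real.exp_add]
      have := mul_le_mul_of_nonneg_left (Real.add_one_le_exp (t * dot d x))
        (Real.exp_pos (dot a x)).le
      linarith
    rw [integral_add (hμ.integrable_exp a) ((hμ.integrable_dot_mul_exp d a).const_mul t),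
      integral_const_mul, ← hμ.genFun_eq_integral, ← hμ.genFun_eq_integral] at hle
    simp only [zero_smul, add_zero, zero_mul, sub_zero]
    linarith
  have := hmin.hasDerivAt_eq_zero hd
  linarith

/-- Strict convexity: φ(a - e) - 1 is the mean of e^{a·x}(e^{-e·x} - 1 + e·x), which is nonnegative
and positive at some atom of μ. -/
lemma FiniteGenFun.one_lt_genFun_sub (hμ : FiniteGenFun μ) {a e : Plane} (ha : genFun μ a = 1)
    (hmean : ∫ x, dot e x * Real.exp (dot a x) ∂μ = 0) (hnd : ∃ x, μ {x} ≠ 0 ∧ dot e x ≠ 0) :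
    1 < genFun μ (a - e) := by
  have hi := (((hμ.integrable_exp (a - e)).sub (hμ.integrable_exp a)).add
    (hμ.integrable_dot_mul_exp e a))
  set f : ℤ × ℤ → ℝ := fun x => Real.exp (dot (a - e) x) - Real.exp (dot a x) +
    dot e x * Real.exp (dot a x) with hf
  have hi : Integrable f μ := hi
  have hfx : ∀ x, f x = Real.exp (dot a x) * (Real.exp (-dot e x) - (-dot e x + 1)) := by
    intro x
    simp only [hf, dot_sub_left, sub_eq_add_neg (dot a x), Real.exp_add]
    ring
  have h0 : ∀ x, 0 ≤ f x := fun x => by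
    rw [hfx]
    exact mul_nonneg (Real.exp_pos _).le (sub_nonneg.2 (Real.add_one_le_exp _))
  obtain ⟨x, hx, hxe⟩ := hnd
  have hpos : 0 < f x := by
    rw [hfx]
    exact mul_pos (Real.exp_pos _) (sub_pos.2 (Real.add_one_lt_exp (neg_ne_zero.2 hxe)))
  have hle := le_hasSum (hasSum_measureReal_mul_of_integrable hi) x
    fun y _ => mul_nonneg measureReal_nonneg (h0 y)
  have hμx : 0 < μ.real {x} := ENNReal.toReal_pos hx (measure_ne_top μ _)
  have hint : ∫ x, f x ∂μ = genFun μ (a - e) - 1 := by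
    have i1 : Integrable (fun x => Real.exp (dot (a - e) x) - Real.exp (dot a x)) μ :=
      (hμ.integrable_exp (a - e)).sub (hμ.integrable_exp a)
    simp only [hf]
    rw [integral_add i1 (hμ.integrable_dot_mul_exp e a),
      integral_sub (hμ.integrable_exp (a - e)) (hμ.integrable_exp a), hmean,
      ← hμ.genFun_eq_integral, ← hμ.genFun_eq_integral, ha, add_zero]
  have := mul_pos hμx hpos
  linarith

end

/-! ### Exponential functions and linear functions times exponentials -/

section

variable {μ : Measure (ℤ × ℤ)} [IsProbabilityMeasure μ]

/-- The exponential function `exp(a · z)` when the mean of the tilted walk lies in the open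
quadrant. -/
lemma killedPart_exp (hμ : FiniteGenFun μ) (hirr : IsIrreducible (killedTransition μ))
    {a e e' : Plane} (hQ : ∀ z, z ∈ quadrant ↔ 0 < dot e z ∧ 0 < dot e' z)
    (hex : ∀ N : ℝ, ∃ z ∈ quadrant, N < dot e z ∧ N < dot e' z) (ha : genFun μ a = 1)
    (he : ∃ t : ℝ, 0 < t ∧ genFun μ (a - t • e) ≤ 1)
    (he' : ∃ t : ℝ, 0 < t ∧ genFun μ (a - t • e') ≤ 1) :
    (∀ z ∈ quadrant, IntegrableOn (fun ξ => Real.exp (dot a (exitPosition z ξ)))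
      {ξ | exitTime z ξ < ⊤} (pathLaw μ)) ∧
    (∀ z ∈ quadrant, 0 < killedPart μ (fun w => Real.exp (dot a w)) z) ∧
    IsHarmonic (killedTransition μ)
      fun z => killedPart μ (fun w => Real.exp (dot a w)) (z : ℤ × ℤ) := by
  have hfin : ∀ z, exitMoment μ (fun w => ‖Real.exp (dot a w)‖ₑ) z ≠ ⊤ :=
    exitMoment_enorm_ne_top_of_superharmonic μ (W := fun w => Real.exp (dot a w))
      (fun w => (Real.exp_pos _).le) (fun w _ => by rw [Real.abs_exp])
      (hμ.integrable_exp_shift a) (fun w _ => by rw [hμ.integral_exp_shift, ha, mul_one])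
  refine killedPart_pos_and_isHarmonic μ hfin (hμ.integrable_exp_shift a)
    (fun z => by rw [hμ.integral_exp_shift, ha, mul_one]) hirr (fun z _ => (Real.exp_pos _).le) ?_
  obtain ⟨s, hs, hs1⟩ := he
  obtain ⟨t, ht, ht1⟩ := he'
  -- Beyond log 2 / s and log 2 / t, each exponential in W is less than half of exp(a · z).
  obtain ⟨z, hz, hz0, hz1⟩ := hex (Real.log 2 / s + Real.log 2 / t)
  have hlog : 0 < Real.log 2 := Real.log_pos one_lt_two
  have half : ∀ {r u : ℝ}, 0 < r → Real.log 2 / r < u → Real.exp (-(r * u)) < 1 / 2 := by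
    intro r u hr hu
    rw [div_lt_iff₀' hr] at hu
    have := Real.exp_lt_exp.2 (neg_lt_neg hu)
    rwa [Real.exp_neg (Real.log 2), Real.exp_log two_pos, ← one_div] at this
  refine ⟨z, hz, killedPart_pos_of_superharmonic μ (hfin z)
    (W := fun w => Real.exp (dot (a - s • e) w) + Real.exp (dot (a - t • e') w))
    (fun w => by positivity) (fun w hw => ?_)
    (fun w => (hμ.integrable_exp_shift _ w).add (hμ.integrable_exp_shift _ w)) (fun w _ => ?_) ?_⟩
  · have hw' : dot e w ≤ 0 ∨ dot e' w ≤ 0 := by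
      by_contra! hcon
      exact hw ((hQ w).2 hcon)
    rcases hw' with h | h
    · have : Real.exp (dot a w) ≤ Real.exp (dot (a - s • e) w) := by
        rw [Real.exp_le_exp, dot_sub_left, dot_smul_left]
        nlinarith
      have := Real.exp_pos (dot (a - t • e') w)
      linarith
    · have : Real.exp (dot a w) ≤ Real.exp (dot (a - t • e') w) := by
        rw [Real.exp_le_exp, dot_sub_left, dot_smul_left]
        nlinarith
      have := Real.exp_pos (dot (a - s • e) w)
      linarith
  · rw [integral_add (hμ.integrable_exp_shift _ w) (hμ.integrable_exp_shift _ w),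
      hμ.integral_exp_shift, hμ.integral_exp_shift]
    exact add_le_add (mul_le_of_le_one_right (Real.exp_pos _).le hs1)
      (mul_le_of_le_one_right (Real.exp_pos _).le ht1)
  · have e1 := half hs (lt_of_le_of_lt (le_add_of_nonneg_right (by positivity)) hz0)
    have e2 := half ht (lt_of_le_of_lt (le_add_of_nonneg_left (by positivity)) hz1)
    simp only [dot_sub_left, dot_smul_left, sub_eq_add_neg (dot a z), Real.exp_add, ← mul_add]
    refine mul_lt_of_lt_one_right (Real.exp_pos _) ?_
    linarith

/-- Up to the factor exp(a · w), the right side is the superharmonic majorant for a centred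
coordinate: -e^{-s} supplies negative drift, and 4e^{-2s} controls |s| for negative s. -/
lemma abs_le_add_exp (s : ℝ) : |s| ≤ s + 1 - Real.exp (-s) + 4 * Real.exp (-s) ^ 2 := by
  have h := Real.add_one_le_exp (-s)
  have hu := Real.exp_pos (-s)
  rcases le_total 0 s with hs | hs
  · rw [abs_of_nonneg hs]
    have : Real.exp (-s) ≤ 1 := Real.exp_le_one_iff.2 (by linarith)
    nlinarith
  · rw [abs_of_nonpos hs]
    nlinarith [sq_nonneg (Real.exp (-s) - 1)]

/-- The function `(e · z) exp(a · z)` when the tilted walk has mean zero in the direction of the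
coordinate `e` and positive mean in the direction of the other coordinate `e'`. -/
lemma killedPart_dot_mul_exp (hμ : FiniteGenFun μ) (hirr : IsIrreducible (killedTransition μ))
    {a e e' : Plane} (hQ : ∀ z, z ∈ quadrant ↔ 0 < dot e z ∧ 0 < dot e' z)
    (hex : ∀ N : ℝ, ∃ z ∈ quadrant, dot e z = 1 ∧ N < dot e' z)
    (ha : genFun μ a = 1) (hmean : ∫ x, dot e x * Real.exp (dot a x) ∂μ = 0)
    (hψ : 1 < genFun μ (a - e)) (hdir : ∃ t : ℝ, 0 < t ∧ genFun μ (a + t • (e - e')) ≤ 1) :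
    (∀ z ∈ quadrant, IntegrableOn
      (fun ξ => dot e (exitPosition z ξ) * Real.exp (dot a (exitPosition z ξ)))
      {ξ | exitTime z ξ < ⊤} (pathLaw μ)) ∧
    (∀ z ∈ quadrant, 0 < killedPart μ (fun w => dot e w * Real.exp (dot a w)) z) ∧
    IsHarmonic (killedTransition μ)
      fun z => killedPart μ (fun w => dot e w * Real.exp (dot a w)) (z : ℤ × ℤ) := by
  have hharm : ∀ z, ∫ x, dot e (z + x) * Real.exp (dot a (z + x)) ∂μ =
      dot e z * Real.exp (dot a z) := fun z => by
    rw [hμ.integral_dot_mul_exp_shift, hmean, ha]; ring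
  have hfin : ∀ z, exitMoment μ (fun w => ‖dot e w * Real.exp (dot a w)‖ₑ) z ≠ ⊤ := by
    -- The majorant is used at s = e · w + y. The shift y is so large that, in the quadrant, the
    -- drift of 4e^{-2s} is absorbed by that of -e^{-s}, which is proportional to φ(a - e) - 1 > 0.
    obtain ⟨y, hy0, hy⟩ : ∃ y : ℝ, 0 ≤ y ∧
        4 * Real.exp (-y) * (genFun μ (a - (2 : ℝ) • e)) ≤ genFun μ (a - e) - 1 := by
      have hlim : Filter.Tendsto (fun y : ℝ =>
          4 * Real.exp (-y) * (genFun μ (a - (2 : ℝ) • e))) Filter.atTop (nhds 0) := by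
        simpa using (Real.tendsto_exp_neg_atTop_nhds_zero.const_mul 4).mul_const
          (genFun μ (a - (2 : ℝ) • e))
      obtain ⟨y, h1, h2⟩ := ((hlim.eventually (ge_mem_nhds (sub_pos.2 hψ))).and
        (Filter.eventually_ge_atTop 0)).exists
      exact ⟨y, h2, h1⟩
    set k := Real.exp (-y) with hk
    have hk0 : 0 < k := Real.exp_pos _
    have hexp : ∀ w, Real.exp (dot (a - e) w) = Real.exp (dot a w) * Real.exp (-dot e w) :=
      fun w => by rw [dot_sub_left, sub_eq_add_neg, Real.exp_add]
    have hexp2 : ∀ w, Real.exp (dot (a - (2 : ℝ) • e) w) =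
        Real.exp (dot a w) * Real.exp (-dot e w) ^ 2 := fun w => by
      rw [dot_sub_left, dot_smul_left, sub_eq_add_neg, Real.exp_add, ← Real.exp_nat_mul]
      push_cast
      ring_nf
    have hWabs : ∀ w, |dot e w * Real.exp (dot a w)| ≤ dot e w * Real.exp (dot a w) +
        (2 * y + 1) * Real.exp (dot a w) - k * Real.exp (dot (a - e) w) +
        4 * k ^ 2 * Real.exp (dot (a - (2 : ℝ) • e) w) := by
      intro w
      have h := abs_le_add_exp (dot e w + y)
      rw [neg_add, Real.exp_add, ← hk] at h
      have h2 : |dot e w| ≤ |dot e w + y| + y := by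
        have := abs_sub (dot e w + y) y
        rwa [add_sub_cancel_right, abs_of_nonneg hy0] at this
      have h3 := mul_le_mul_of_nonneg_right (h2.trans (add_le_add_left h y))
        (Real.exp_pos (dot a w)).le
      rw [abs_mul, Real.abs_exp, hexp, hexp2]
      refine h3.trans_eq ?_
      ring
    have i1 := fun w => hμ.integrable_dot_mul_exp_shift e a w
    have i2 := fun w => (hμ.integrable_exp_shift a w).const_mul (2 * y + 1)
    have i3 := fun w => (hμ.integrable_exp_shift (a - e) w).const_mul k
    have i4 := fun w => (hμ.integrable_exp_shift (a - (2 : ℝ) • e) w).const_mul (4 * k ^ 2)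
    refine exitMoment_enorm_ne_top_of_superharmonic μ
      (fun w => (abs_nonneg _).trans (hWabs w)) (fun w _ => hWabs w)
      (fun w => (((i1 w).add (i2 w)).sub (i3 w)).add (i4 w)) (fun w hw => ?_)
    have j2 : Integrable (fun x => dot e (w + x) * Real.exp (dot a (w + x)) +
        (2 * y + 1) * Real.exp (dot a (w + x))) μ := (i1 w).add (i2 w)
    have j3 : Integrable (fun x => dot e (w + x) * Real.exp (dot a (w + x)) +
        (2 * y + 1) * Real.exp (dot a (w + x)) - k * Real.exp (dot (a - e) (w + x))) μ :=
      j2.sub (i3 w)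
    rw [integral_add j3 (i4 w), integral_sub j2 (i3 w), integral_add (i1 w) (i2 w), hharm,
      integral_const_mul, integral_const_mul, integral_const_mul, hμ.integral_exp_shift,
      hμ.integral_exp_shift, hμ.integral_exp_shift, ha, hexp, hexp2]
    have hv0 := Real.exp_pos (-dot e w)
    have hv1 : Real.exp (-dot e w) ≤ 1 :=
      Real.exp_le_one_iff.2 (neg_nonpos.2 ((hQ w).1 hw).1.le)
    set v := Real.exp (-dot e w)
    set A := Real.exp (dot a w) with hA
    have hA0 : 0 < A := Real.exp_pos _
    set C := genFun μ (a - (2 : ℝ) • e)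
    have hψ' : 0 < genFun μ (a - e) - 1 := sub_pos.2 hψ
    have hC : 4 * k * C * v ≤ genFun μ (a - e) - 1 := by
      calc 4 * k * C * v ≤ (genFun μ (a - e) - 1) * v := by gcongr
        _ ≤ genFun μ (a - e) - 1 := mul_le_of_le_one_right hψ'.le hv1
    have h5 := mul_le_mul_of_nonneg_left hC (by positivity : 0 ≤ A * k * v)
    have h6 : 0 ≤ 4 * k ^ 2 * (A * v ^ 2) := by positivity
    nlinarith
  refine killedPart_pos_and_isHarmonic μ hfin (hμ.integrable_dot_mul_exp_shift e a) hharm hirr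
    (fun z hz => mul_nonneg ((hQ z).1 hz).1.le (Real.exp_pos _).le) ?_
  obtain ⟨t, ht, ht1⟩ := hdir
  -- With e · z = 1, the inequality W(z) < b(z) reads e^{t(e'·z - 1)} > 1/t; this bound on e' · z
  -- makes the exponent exceed 1/t, which suffices.
  obtain ⟨z, hz, hze, hze'⟩ := hex (1 + t⁻¹ * t⁻¹)
  have hexp : ∀ w, Real.exp (dot (a + t • (e - e')) w) =
      Real.exp (dot a w) * Real.exp (t * (dot e w - dot e' w)) :=
    fun w => by rw [dot_add_left, dot_smul_left, dot_sub_left, Real.exp_add]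
  refine ⟨z, hz, killedPart_pos_of_superharmonic μ (hfin z)
    (W := fun w => t⁻¹ * Real.exp (dot (a + t • (e - e')) w)) (fun w => by positivity)
    (fun w hw => ?_) (fun w => (hμ.integrable_exp_shift _ w).const_mul _) (fun w _ => ?_) ?_⟩
  -- If e · w ≤ 0 then b ≤ 0 ≤ W. Otherwise e' · w ≤ 0, and t(e · w) ≤ exp(t(e · w - e' · w)).
  · rcases le_or_gt (dot e w) 0 with h | h
    · exact (mul_nonpos_of_nonpos_of_nonneg h (Real.exp_pos _).le).trans (by positivity)
    · have h' : dot e' w ≤ 0 := not_lt.1 fun hlt => hw ((hQ w).2 ⟨h, hlt⟩)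
      have h1 := Real.add_one_le_exp (t * (dot e w - dot e' w))
      have h2 : t * dot e w ≤ Real.exp (t * (dot e w - dot e' w)) := by nlinarith
      rw [hexp, ← mul_assoc, mul_right_comm]
      refine mul_le_mul_of_nonneg_right ?_ (Real.exp_pos _).le
      rwa [inv_mul_eq_div, le_div_iff₀' ht]
  · rw [integral_const_mul, hμ.integral_exp_shift]
    exact mul_le_mul_of_nonneg_left (mul_le_of_le_one_right (Real.exp_pos _).le ht1)
      (inv_nonneg.2 ht.le)
  · rw [hexp, hze, one_mul, mul_left_comm]
    refine mul_lt_of_lt_one_right (Real.exp_pos _) ?_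
    rw [inv_mul_eq_div, div_lt_one ht]
    have h1 : t⁻¹ < t * (dot e' z - 1) := by
      have := mul_lt_mul_of_pos_left hze' ht
      have h3 : t * (1 + t⁻¹ * t⁻¹) = t + t⁻¹ := by field_simp
      linarith
    have h2 := Real.add_one_le_exp (t * (dot e' z - 1))
    have h3 : t * (1 - dot e' z) = -(t * (dot e' z - 1)) := by ring
    rw [h3, Real.exp_neg]
    exact inv_lt_of_inv_lt₀ ht (by linarith)

end

end KilledWalk

end

/-! ### The three cases for the direction q(a) -/

theorem proposition4p1 (μ : MeasureTheory.Measure (ℤ × ℤ))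
    [MeasureTheory.IsProbabilityMeasure μ]
    (h_irred : KilledWalk.IsIrreducible (KilledWalk.walkTransition μ))
    (h_mean : KilledWalk.meanJump μ ≠ 0)
    (h_killed : KilledWalk.IsIrreducible (KilledWalk.killedTransition μ))
    (h_gen : KilledWalk.FiniteGenFun μ)
    (h_aper₁ : KilledWalk.IsAperiodic (KilledWalk.walkTransition (μ.map Prod.fst)))
    (h_aper₂ : KilledWalk.IsAperiodic (KilledWalk.walkTransition (μ.map Prod.snd)))
    (a : KilledWalk.Plane) (ha : a ∈ KilledWalk.gammaPlus μ) :
    (∀ z ∈ KilledWalk.quadrant, KilledWalk.FiniteExitExpectation μ a z) ∧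
    (∀ z ∈ KilledWalk.quadrant, 0 < KilledWalk.h μ a z) ∧
    KilledWalk.IsHarmonic (KilledWalk.killedTransition μ)
      (fun z => KilledWalk.h μ a (z : ℤ × ℤ)) := by
  open KilledWalk in
  obtain ⟨ha1, hnorm, hq0, hq1⟩ := ha
  have ha1 : genFun μ a = 1 := ha1
  set G := gradient (genFun μ) a with hG
  have hq : direction μ a = ‖G‖⁻¹ • G := rfl
  have hG0 : G ≠ 0 := by
    rintro h0
    rw [hq, h0] at hnorm
    simp at hnorm
  have hGn : 0 < ‖G‖⁻¹ := inv_pos.2 (norm_pos_iff.2 hG0)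
  -- `gradient` is 0 at points of non-differentiability, so |q(a)| = 1 already forces
  -- differentiability.
  have hdiff : DifferentiableAt ℝ (genFun μ) a := by
    by_contra hnd
    exact hG0 (gradient_eq_zero_of_not_differentiableAt hnd)
  have hinner : ∀ d : Plane, inner ℝ G d = G 0 * d 0 + G 1 * d 1 := fun d => by
    rw [PiLp.inner_apply, Fin.sum_univ_two]
    simp [mul_comm]
  have hqi : ∀ i, direction μ a i = ‖G‖⁻¹ * G i := fun i => by rw [hq]; rfl
  have hsq : direction μ a 0 ^ 2 + direction μ a 1 ^ 2 = 1 := by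
    have := EuclideanSpace.real_norm_sq_eq (direction μ a)
    rw [hnorm, Fin.sum_univ_two] at this
    linarith
  have hdescent : ∀ d : Plane, inner ℝ G d < 0 →
      ∃ t : ℝ, 0 < t ∧ genFun μ (a + t • d) ≤ 1 := fun d hd => by
    obtain ⟨t, ht, hlt⟩ := exists_genFun_lt hdiff hd
    exact ⟨t, ht, (hlt.trans_eq ha1).le⟩
  -- Both axis directions at once: e is the coordinate vector orthogonal to ∇φ(a), and e' the other.
  -- Then φ decreases from a along e - e'.
  have hboundary : ∀ e e' : Plane, (∀ z, z ∈ quadrant ↔ 0 < dot e z ∧ 0 < dot e' z) →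
      (∀ N : ℝ, ∃ z ∈ quadrant, dot e z = 1 ∧ N < dot e' z) → inner ℝ G e = 0 →
      0 < inner ℝ G e' → base μ a = (fun w => dot e w * Real.exp (dot a w)) →
      (∀ z ∈ quadrant, FiniteExitExpectation μ a z) ∧ (∀ z ∈ quadrant, 0 < h μ a z) ∧
      IsHarmonic (killedTransition μ) (fun z => h μ a (z : ℤ × ℤ)) := by
    intro e e' hQ hex he he' hb
    have hmean : ∫ x, dot e x * Real.exp (dot a x) ∂μ = 0 := by
      rw [← h_gen.inner_gradient hdiff, he]
    have hnd : ∃ x, μ {x} ≠ 0 ∧ dot e x ≠ 0 := by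
      obtain ⟨z, -, hz, -⟩ := hex 0
      exact exists_dot_ne_zero_of_irreducible h_irred ⟨z, by rw [hz]; exact one_ne_zero⟩
    have := killedPart_dot_mul_exp h_gen h_killed hQ hex ha1 hmean
      (h_gen.one_lt_genFun_sub ha1 hmean hnd)
      (hdescent (e - e') (by rw [inner_sub_right, he]; linarith))
    unfold FiniteExitExpectation KilledWalk.h
    rw [hb]
    exact this
  by_cases hq01 : direction μ a = !₂[0, 1]
  · have h0 : ‖G‖⁻¹ * G 0 = 0 := by rw [← hqi, hq01]; rfl
    have h1 : ‖G‖⁻¹ * G 1 = 1 := by rw [← hqi, hq01]; rfl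
    refine hboundary !₂[1, 0] !₂[0, 1] (fun z => ?_) (fun N => ?_) ?_ ?_ ?_
    · simp [dot_fst, dot_snd, quadrant]
    · obtain ⟨n, hn⟩ := exists_nat_gt N
      refine ⟨(1, n + 1), ⟨by positivity, by positivity⟩, by simp [dot_fst], ?_⟩
      rw [dot_snd]; push_cast; linarith
    · rw [hinner]; simpa [hGn.ne'] using h0
    · rw [hinner]; simpa using (mul_pos_iff_of_pos_left hGn).1 (h1 ▸ one_pos)
    · funext w; simp [base, hq01, dot_fst]
  by_cases hq10 : direction μ a = !₂[1, 0]
  · have h0 : ‖G‖⁻¹ * G 0 = 1 := by rw [← hqi, hq10]; rfl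
    have h1 : ‖G‖⁻¹ * G 1 = 0 := by rw [← hqi, hq10]; rfl
    refine hboundary !₂[0, 1] !₂[1, 0] (fun z => ?_) (fun N => ?_) ?_ ?_ ?_
    · simp [dot_fst, dot_snd, quadrant, and_comm]
    · obtain ⟨n, hn⟩ := exists_nat_gt N
      refine ⟨(n + 1, 1), ⟨by positivity, by positivity⟩, by simp [dot_snd], ?_⟩
      rw [dot_fst]; push_cast; linarith
    · rw [hinner]; simpa [hGn.ne'] using h1
    · rw [hinner]; simpa using (mul_pos_iff_of_pos_left hGn).1 (h0 ▸ one_pos)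
    · funext w
      unfold base
      rw [if_neg hq01, if_pos hq10, dot_snd]
  -- Were a component of q(a) zero, the unit norm and the signs would make q(a) one of the excluded
  -- coordinate vectors. So both partial derivatives are positive, and φ decreases along -e and
  -- along -e'.
  · have hG0 : 0 < G 0 := by
      refine (mul_pos_iff_of_pos_left hGn).1 ?_
      rw [← hqi]
      refine hq0.lt_of_ne fun h0 => hq01 ?_
      rw [← h0] at hsq
      have h1 : direction μ a 1 = 1 := by nlinarith
      ext i
      fin_cases i
      · exact h0.symm
      · exact h1
    have hG1 : 0 < G 1 := by
      refine (mul_pos_iff_of_pos_left hGn).1 ?_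
      rw [← hqi]
      refine hq1.lt_of_ne fun h1 => hq10 ?_
      rw [← h1] at hsq
      have h0 : direction μ a 0 = 1 := by nlinarith
      ext i
      fin_cases i
      · exact h0
      · exact h1.symm
    have hb : base μ a = fun w => Real.exp (dot a w) := by
      funext w
      unfold base
      rw [if_neg hq01, if_neg hq10]
    have := killedPart_exp h_gen h_killed (e := !₂[1, 0]) (e' := !₂[0, 1])
      (fun z => by simp [dot_fst, dot_snd, quadrant])
      (fun N => by
        obtain ⟨n, hn⟩ := exists_nat_gt N
        refine ⟨(n + 1, n + 1), ⟨by positivity, by positivity⟩, ?_, ?_⟩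
        · rw [dot_fst]; push_cast; linarith
        · rw [dot_snd]; push_cast; linarith) ha1
      (by simpa [sub_eq_add_neg] using hdescent (-!₂[1, 0]) (by
        rw [inner_neg_right, hinner]; simpa using hG0))
      (by simpa [sub_eq_add_neg] using hdescent (-!₂[0, 1]) (by
        rw [inner_neg_right, hinner]; simpa using hG1))
    unfold FiniteExitExpectation KilledWalk.h
    rw [hb]
    exact this
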